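/- Let $n,k,p\ge 1$ be integers, let $X\in\mathcal M_{nk}(\mathbb C)=\mathcal M_n(\mathbb C)\otimes\mathcal M_k(\mathbb C)$ be a deterministic matrix, let $U$ be a Haar-distributed random unitary matrix in $\mathcal U(nk)$, and let $$Y=\mathrm{tr}_k[UXU^*]\in\mathcal M_n(\mathbb C),$$ where $\mathrm{tr}_k$ is the (non-normalized) partial trace over the second tensor factor $\mathcal M_k(\mathbb C)$. For a permutation $\sigma\in\mathcal S_p$ let $\#\sigma$ be its number of cycles (fixed points included), let $\mathrm{tr}_\sigma(X)=\prod_{c}\mathrm{tr}(X^{|c|})$, the product being over all cycles $c$ of $\sigma$ (fixed points included) and $|c|$ denoting the length of $c$, and let $\gamma=(p\;\,p-1\;\cdots\;2\;\,1)\in\mathcal S_p$. Let $\mathrm{Wg}=\mathrm{Wg}(nk,\cdot)$ be the unitary Weingarten function on $\mathcal S_p$, i.e. the inverse of the function $\sigma\mapsto (nk)^{\#\sigma}$ for convolution on $\mathcal S_p$ or, when this function is not invertible, its (Moore–Penrose) pseudo-inverse for convolution, with respect to the involution $f^*(\sigma)=\overline{f(\sigma^{-1})}$. Then $\mathrm{tr}(Y^p)$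 is integrable and $$\mathbb E[\mathrm{tr}(Y^p)]=\sum_{\alpha,\beta\in\mathcal S_p}k^{\#\alpha}\,n^{\#(\gamma^{-1}\alpha)}\,\mathrm{tr}_\beta(X)\,\mathrm{Wg}(\alpha\beta^{-1}).$$ If moreover $X$ is a rank-one projector ($X^2=X$ and $\operatorname{rank}X=1$; $X$ need not be self-adjoint), then $$\mathbb E[\mathrm{tr}(Y^p)]=\Big(\prod_{j=0}^{p-1}(nk+j)\Big)^{-1}\sum_{\alpha\in\mathcal S_p}k^{\#\alpha}\,n^{\#(\gamma^{-1}\alpha)}.$$ -/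

import Mathlib

open MeasureTheory

namespace RandomPartialTrace

/-- The partial trace `tr_k : M_n(ℂ) ⊗ M_k(ℂ) → M_n(ℂ)` over the second tensor factor
(non-normalized), matrices of size `nk` being indexed by `Fin n × Fin k`. -/
def partialTrace {n k : ℕ} (M : Matrix (Fin n × Fin k) (Fin n × Fin k) ℂ) :
    Matrix (Fin n) (Fin n) ℂ :=
  Matrix.of fun i j => ∑ s : Fin k, M (i, s) (j, s)

/-- The number `#σ` of cycles of the permutation `σ`, fixed points included. -/
def numCycles {p : ℕ} (σ : Equiv.Perm (Fin p)) : ℕ :=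
  Multiset.card σ.partition.parts

/-- `tr_σ(X) = ∏_c tr(X^{|c|})`, the product being over the cycles `c` of `σ`, fixed points
included (`σ.partition.parts` is the multiset of the lengths of these cycles). -/
noncomputable def tracePerm {ι : Type*} [Fintype ι] [DecidableEq ι] {p : ℕ}
    (σ : Equiv.Perm (Fin p)) (X : Matrix ι ι ℂ) : ℂ :=
  (σ.partition.parts.map fun m => (X ^ m).trace).prod

/-- The full cycle `γ = (p, p-1, …, 2, 1)` of `S_p`, which sends each point to the preceding one
(cyclically); `finRotate p` is `i ↦ i + 1` modulo `p`. -/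
def gammaCycle (p : ℕ) : Equiv.Perm (Fin p) := (finRotate p)⁻¹

section Convolution

set_option linter.unusedSectionVars false

/-- Convolution of complex functions on a finite group. -/
def conv {G : Type*} [Group G] [Fintype G] (f g : G → ℂ) : G → ℂ :=
  fun σ => ∑ τ : G, f τ * g (τ⁻¹ * σ)

/-- `w` is the (Moore-Penrose) pseudo-inverse of `f` for convolution, with respect to the
involution `h ↦ (σ ↦ conj (h σ⁻¹))`. -/
structure IsConvPseudoInverse {G : Type*} [Group G] [Fintype G] (f w : G → ℂ) : Prop where
  left : conv (conv f w) f = f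
  right : conv (conv w f) w = w
  left_selfAdjoint : ∀ σ, conv f w σ⁻¹ = star (conv f w σ)
  right_selfAdjoint : ∀ σ, conv w f σ⁻¹ = star (conv w f σ)

variable {G : Type*} [Group G] [Fintype G]

/-- The matrix of left convolution by `f`. -/
def convMatrix (f : G → ℂ) : Matrix G G ℂ := Matrix.of fun σ τ => f (σ * τ⁻¹)

theorem convMatrix_injective : Function.Injective (convMatrix : (G → ℂ) → Matrix G G ℂ) := by
  intro f g h
  funext σ
  simpa [convMatrix] using congrFun (congrFun h σ) 1

theorem convMatrix_conv (f g : G → ℂ) :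
    convMatrix (conv f g) = convMatrix f * convMatrix g := by
  ext σ ρ
  simp only [convMatrix, conv, Matrix.mul_apply, Matrix.of_apply]
  refine Fintype.sum_equiv ((Equiv.inv G).trans (Equiv.mulRight σ)) _ _ fun τ => ?_
  simp [mul_assoc]

theorem convMatrix_isHermitian {f : G → ℂ} :
    (convMatrix f).IsHermitian ↔ ∀ σ, f σ⁻¹ = star (f σ) := by
  constructor
  · intro h σ
    have := congrFun (congrFun h 1) σ
    simp only [convMatrix, Matrix.conjTranspose_apply, Matrix.of_apply, inv_one, mul_one,
      one_mul] at this
    exact this.symm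
  · intro h
    ext σ τ
    simp only [convMatrix, Matrix.conjTranspose_apply, Matrix.of_apply]
    rw [← h]
    simp

theorem IsConvPseudoInverse.unique {f v w : G → ℂ}
    (hv : IsConvPseudoInverse f v) (hw : IsConvPseudoInverse f w) : v = w := by
  apply convMatrix_injective
  have e1 := congrArg convMatrix hv.left
  have e2 := congrArg convMatrix hv.right
  have e3 := convMatrix_isHermitian.2 hv.left_selfAdjoint
  have e4 := convMatrix_isHermitian.2 hv.right_selfAdjoint
  have f1 := congrArg convMatrix hw.left
  have f2 := congrArg convMatrix hw.right
  have f3 := convMatrix_isHermitian.2 hw.left_selfAdjoint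
  have f4 := convMatrix_isHermitian.2 hw.right_selfAdjoint
  simp only [convMatrix_conv] at e1 e2 e3 e4 f1 f2 f3 f4
  generalize convMatrix f = A at *
  generalize convMatrix v = X at *
  generalize convMatrix w = Y at *
  have h1 : A * X = A * Y := by
    calc A * X = (A * Y) * (A * X) := by rw [← mul_assoc, f1]
      _ = ((A * X) * (A * Y)).conjTranspose := by
        rw [Matrix.conjTranspose_mul, f3.eq, e3.eq]
      _ = (A * Y).conjTranspose := by rw [← mul_assoc, e1]
      _ = A * Y := f3.eq
  have h2 : X * A = Y * A := by
    calc X * A = (X * A) * (Y * A) := by rw [mul_assoc, ← mul_assoc A, f1]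
      _ = ((Y * A) * (X * A)).conjTranspose := by
        rw [Matrix.conjTranspose_mul, f4.eq, e4.eq]
      _ = (Y * A).conjTranspose := by rw [mul_assoc, ← mul_assoc A, e1]
      _ = Y * A := f4.eq
  calc X = X * A * X := e2.symm
    _ = Y * A * X := by rw [h2]
    _ = Y * A * Y := by rw [mul_assoc, h1, ← mul_assoc]
    _ = Y := f2

theorem conv_comm_of_class {f : G → ℂ} (hf : ∀ σ τ, f (σ * τ) = f (τ * σ)) (g : G → ℂ) :
    conv f g = conv g f := by
  funext σ
  refine Fintype.sum_equiv ((Equiv.inv G).trans (Equiv.mulRight σ)) _ _ fun τ => ?_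
  simp only [Equiv.trans_apply, Equiv.inv_apply, Equiv.coe_mulRight, mul_inv_rev, inv_inv]
  rw [mul_comm, hf (σ⁻¹ * τ) σ]
  simp

open scoped ComplexOrder in
/-- A Hermitian class function on a finite group has a convolution pseudo-inverse. -/
theorem exists_isConvPseudoInverse {f : G → ℂ} (hf : ∀ σ τ, f (σ * τ) = f (τ * σ))
    (hs : ∀ σ, f σ⁻¹ = star (f σ)) : ∃ w, IsConvPseudoInverse f w := by
  let L : (G → ℂ) →ₗ[ℂ] (G → ℂ) :=
    { toFun := conv f
      map_add' := fun a b => by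
        funext σ; simp [conv, mul_add, Finset.sum_add_distrib]
      map_smul' := fun c a => by
        funext σ; simp [conv, Finset.mul_sum, mul_left_comm] }
  have hH := convMatrix_isHermitian.2 hs
  have hker : LinearMap.ker (L ∘ₗ L) = LinearMap.ker L := by
    apply le_antisymm _ (LinearMap.ker_le_ker_comp L L)
    intro a ha
    have ha' : conv f (conv f a) = 0 := ha
    have h0 : convMatrix (0 : G → ℂ) = 0 := by ext; simp [convMatrix]
    have h1 := congrArg convMatrix ha'
    rw [convMatrix_conv, convMatrix_conv, h0] at h1
    have h2 : (convMatrix f * convMatrix a).conjTranspose * (convMatrix f * convMatrix a) = 0 := by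
      rw [Matrix.conjTranspose_mul, hH.eq, mul_assoc, h1, mul_zero]
    have h3 := Matrix.conjTranspose_mul_self_eq_zero.1 h2
    rw [← convMatrix_conv, ← h0] at h3
    exact convMatrix_injective h3
  have hrange : LinearMap.range (L ∘ₗ L) = LinearMap.range L := by
    apply Submodule.eq_of_le_of_finrank_eq (LinearMap.range_comp_le_range L L)
    have e1 := LinearMap.finrank_range_add_finrank_ker (L ∘ₗ L)
    have e2 := LinearMap.finrank_range_add_finrank_ker L
    rw [hker] at e1
    omega
  classical
  have hmem : f ∈ LinearMap.range (L ∘ₗ L) := by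
    rw [hrange]
    refine ⟨Pi.single 1 1, ?_⟩
    change conv f (Pi.single 1 1) = f
    rw [conv_comm_of_class hf]
    funext σ
    simp [conv, Pi.single_apply]
  obtain ⟨b, hb⟩ := hmem
  have hb' : conv f (conv f b) = f := hb
  have hb2 := congrArg convMatrix hb'
  have hc := congrArg convMatrix (conv_comm_of_class hf b)
  simp only [convMatrix_conv] at hb2 hc
  have hc' : Commute (convMatrix f) (convMatrix b) := hc
  have key : convMatrix f * convMatrix b * convMatrix f = convMatrix f := by
    rw [mul_assoc, ← hc'.eq, hb2]
  have key2 : convMatrix f * (convMatrix b * convMatrix f * convMatrix b)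
      = convMatrix f * convMatrix b := by
    rw [← mul_assoc, ← mul_assoc, key]
  have key3 : convMatrix b * convMatrix f * convMatrix b * convMatrix f
      = convMatrix f * convMatrix b := by
    rw [mul_assoc, mul_assoc, ← mul_assoc (convMatrix f), key, hc'.eq]
  have hherm : (convMatrix f * convMatrix b).IsHermitian := by
    have : (convMatrix f * convMatrix b).conjTranspose * (convMatrix f * convMatrix b)
        = convMatrix f * convMatrix b := by
      have t := congrArg Matrix.conjTranspose key
      rw [Matrix.conjTranspose_mul, hH.eq, hc'.eq] at t
      have t' : (convMatrix f * convMatrix b).conjTranspose * convMatrix f = convMatrix f := by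
        have u := congrArg Matrix.conjTranspose hb2
        rw [Matrix.conjTranspose_mul, hH.eq] at u
        exact u
      rw [← mul_assoc, t']
    rw [← this]
    exact Matrix.isHermitian_conjTranspose_mul_self _
  refine ⟨conv (conv b f) b, ?_, ?_, ?_, ?_⟩
  · apply convMatrix_injective
    simp only [convMatrix_conv]
    rw [key2, key]
  · apply convMatrix_injective
    simp only [convMatrix_conv]
    rw [key3]
    calc convMatrix f * convMatrix b * (convMatrix b * convMatrix f * convMatrix b)
        = convMatrix b * convMatrix f * (convMatrix b * convMatrix f * convMatrix b) := by
          rw [hc'.eq]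
      _ = convMatrix b * (convMatrix f * convMatrix b * convMatrix f) * convMatrix b := by
          simp only [mul_assoc]
      _ = convMatrix b * convMatrix f * convMatrix b := by rw [key]
  · apply convMatrix_isHermitian.1
    simp only [convMatrix_conv]
    rwa [key2]
  · apply convMatrix_isHermitian.1
    simp only [convMatrix_conv]
    rwa [key3]

end Convolution

/-- The function `σ ↦ d^{#σ}` on `S_p`. -/
def cyclePow (d p : ℕ) : Equiv.Perm (Fin p) → ℂ := fun σ => (d : ℂ) ^ numCycles σ

theorem cyclePow_class (d p : ℕ) (σ τ : Equiv.Perm (Fin p)) :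
    cyclePow d p (σ * τ) = cyclePow d p (τ * σ) := by
  have h : IsConj (σ * τ) (τ * σ) := isConj_iff.2 ⟨τ, by group⟩
  simp only [cyclePow, numCycles, Equiv.Perm.partition_eq_of_isConj.1 h]

theorem cyclePow_inv (d p : ℕ) (σ : Equiv.Perm (Fin p)) :
    cyclePow d p σ⁻¹ = star (cyclePow d p σ) := by
  simp [cyclePow, numCycles, Equiv.Perm.parts_partition]

/-- The unitary Weingarten function `Wg(d, ·)` on `S_p`: the pseudo-inverse of `σ ↦ d^{#σ}` for
convolution. It exists by `exists_isConvPseudoInverse` and is unique by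
`IsConvPseudoInverse.unique`; it is the inverse whenever there is one (`weingarten_inverse`). -/
noncomputable def weingarten (d p : ℕ) : Equiv.Perm (Fin p) → ℂ :=
  Classical.choose (exists_isConvPseudoInverse (cyclePow_class d p) (cyclePow_inv d p))

theorem weingarten_spec (d p : ℕ) : IsConvPseudoInverse (cyclePow d p) (weingarten d p) :=
  Classical.choose_spec (exists_isConvPseudoInverse (cyclePow_class d p) (cyclePow_inv d p))

/-- If `σ ↦ d^{#σ}` has a convolution inverse `v`, then `v` is the Weingarten function. -/
theorem weingarten_inverse (d p : ℕ) (v : Equiv.Perm (Fin p) → ℂ)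
    (hv : conv (cyclePow d p) v = Pi.single 1 1) : weingarten d p = v := by
  have hv' : conv v (cyclePow d p) = Pi.single 1 1 := by
    rw [← conv_comm_of_class (cyclePow_class d p), hv]
  have one_conv : ∀ g : Equiv.Perm (Fin p) → ℂ, conv (Pi.single 1 1) g = g := fun g => by
    funext σ
    simp [conv, Pi.single_apply]
  have hs : ∀ σ : Equiv.Perm (Fin p),
      (Pi.single 1 1 : Equiv.Perm (Fin p) → ℂ) σ⁻¹
        = star ((Pi.single 1 1 : Equiv.Perm (Fin p) → ℂ) σ) := fun σ => by
    by_cases h : σ = 1 <;> simp [h]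
  refine (weingarten_spec d p).unique ⟨?_, ?_, ?_, ?_⟩
  · rw [hv, one_conv]
  · rw [hv', one_conv]
  · rw [hv]; exact hs
  · rw [hv']; exact hs

end RandomPartialTrace

/-! Put d = nk. Expanding tr(Y^p) in coordinates makes it a fixed linear form in the entries of
(UXU*)^{⊗p} (`trace_pow_partialTrace`), so only A = E[(UXU*)^{⊗p}] matters. Left invariance of Haar
measure makes A commute with every W^{⊗p}, W unitary, so Schur–Weyl duality writes A = ∑ c(α) P_α
with P_α permuting the tensor factors. Duality comes from Zariski density of the unitary group
(`eq_zero_of_eval_unitary`) and the Jacobson density theorem for the group algebra of S_p.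

Traces are invariant under conjugation, so tr(A P_σ) = tr_σ(X); since tr(P_σ) = d^{#σ}, this says
that c convolved with σ ↦ d^{#σ} equals σ ↦ tr_σ(X). When d^{#} is not invertible, c is not unique,
but A is: a combination of the P_α with zero trace against every P_σ vanishes. Hence the
pseudo-inverse Wg yields valid coefficients (`sum_permOp_eq_sum_weingarten`). Applying the linear
form to P_α counts index functions constant on cycles and gives k^{#α} n^{#(γ⁻¹α)}
(`sum_permOp_partialTrace`).

If X is a rank-one idempotent, all tr_β(X) are 1, so A = s ∑ P_α for a scalar s. Then 1 = tr A = s ∑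
d^{#α}, and Burnside's lemma evaluates this sum as d(d+1)⋯(d+p-1) (`sum_cyclePow`). -/

namespace RandomPartialTrace

/-! ### Products of power traces as sums over index functions. -/

section CycleTraces

open Finset

variable {α ι : Type*} [Fintype α] [DecidableEq α] [Fintype ι] [DecidableEq ι]

/-- The sum over `f : α → ι` of `∏ N (f l) (f (σ l))`, the product being over `l ∈ S` and the values
of `f` outside `S` being pinned to `i₀`. -/
def pinnedSum (N : Matrix ι ι ℂ) (i₀ : ι) (S : Finset α) (σ : Equiv.Perm α) : ℂ :=
  ∑ f : α → ι, ∏ l, if l ∈ S then N (f l) (f (σ l)) else if f l = i₀ then 1 else 0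

theorem pinnedSum_one (N : Matrix ι ι ℂ) (i₀ : ι) (S : Finset α) :
    pinnedSum N i₀ S 1 = N.trace ^ #S := by
  have h := Finset.prod_univ_sum (fun _ : α => (Finset.univ : Finset ι))
    (fun l i => if l ∈ S then N i i else if i = i₀ then (1 : ℂ) else 0)
  simp only [Fintype.piFinset_univ] at h
  simp only [pinnedSum, Equiv.Perm.one_apply]
  rw [← h]
  have h2 : ∀ l : α, (∑ i : ι, if l ∈ S then N i i else if i = i₀ then (1 : ℂ) else 0)
      = if l ∈ S then N.trace else 1 := fun l => by
    split_ifs <;> simp [Matrix.trace]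
  simp only [h2, Finset.prod_ite_mem, Finset.univ_inter, Finset.prod_const]

/-- Pinning is what makes the sum multiplicative, as induction over disjoint cycles requires: each
factor only sees the values on its own set. -/
theorem pinnedSum_mul (N : Matrix ι ι ℂ) (i₀ : ι) {S T : Finset α} {σ τ : Equiv.Perm α}
    (hST : Disjoint S T) (hσ : ∀ l ∉ S, σ l = l) (hτ : ∀ l ∉ T, τ l = l) :
    pinnedSum N i₀ S σ * pinnedSum N i₀ T τ = pinnedSum N i₀ (S ∪ T) (σ * τ) := by
  have h1 : pinnedSum N i₀ (∅ : Finset α) 1 = 1 := by simp [pinnedSum_one]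
  -- With the extra factor for `∅`, both sides are sums over pairs of functions, matched by
  -- exchanging the two values outside `S`; the second function becomes pinned everywhere.
  rw [← mul_one (pinnedSum N i₀ (S ∪ T) (σ * τ)), ← h1]
  have hswap : ∀ x : (α → ι) × (α → ι),
      (S.piecewise (S.piecewise x.1 x.2) (S.piecewise x.2 x.1),
        S.piecewise (S.piecewise x.2 x.1) (S.piecewise x.1 x.2)) = x := fun x => by
    ext l <;> by_cases hl : l ∈ S <;> simp [hl]
  simp only [pinnedSum, Finset.sum_mul_sum, ← Finset.prod_mul_distrib, ← Fintype.sum_prod_type']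
  refine Finset.sum_nbij' (fun x => (S.piecewise x.1 x.2, S.piecewise x.2 x.1))
    (fun x => (S.piecewise x.1 x.2, S.piecewise x.2 x.1)) (by simp) (by simp)
    (fun x _ => hswap x) (fun x _ => hswap x)
    (fun x _ => Finset.prod_congr rfl fun l _ => ?_)
  · have hσS : ∀ l ∈ S, σ l ∈ S := fun l hl => by
      by_contra h
      exact h ((σ.injective (hσ _ h)).symm ▸ hl)
    have hτT : ∀ l ∈ T, τ l ∈ T := fun l hl => by
      by_contra h
      exact h ((τ.injective (hτ _ h)).symm ▸ hl)
    by_cases hS : l ∈ S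
    · have hT : l ∉ T := Finset.disjoint_left.1 hST hS
      simp [hS, hT, hτ l hT, hσS l hS]
    · by_cases hT : l ∈ T
      · have h3 : τ l ∉ S := Finset.disjoint_right.1 hST (hτT l hT)
        simp [hS, hT, hσ _ h3, h3, mul_comm]
      · simp [hS, hT, mul_comm]

theorem pow_apply_eq_sum_walk (N : Matrix ι ι ℂ) (m : ℕ) (a b : ι) :
    (N ^ (m + 1)) a b = ∑ g : Fin m → ι, ∏ i : Fin (m + 1),
      N ((Fin.cons a g : Fin (m + 1) → ι) i) ((Fin.snoc g b : Fin (m + 1) → ι) i) := by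
  induction m generalizing a with
  | zero => simp [Fin.snoc]
  | succ m ih =>
    rw [pow_succ', Matrix.mul_apply]
    simp only [ih]
    rw [← (Fin.consEquiv (fun _ => ι)).sum_comp, Fintype.sum_prod_type]
    refine Finset.sum_congr rfl fun c _ => ?_
    rw [Finset.mul_sum]
    refine Finset.sum_congr rfl fun g _ => ?_
    rw [Fin.prod_univ_succ (n := m + 1)]
    simp only [Fin.consEquiv, Equiv.coe_fn_mk, Fin.cons_zero, Fin.cons_succ,
      ← Fin.cons_snoc_eq_snoc_cons]

theorem trace_pow_eq_sum_rotate (N : Matrix ι ι ℂ) {m : ℕ} (hm : m ≠ 0) :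
    (N ^ m).trace = ∑ g : Fin m → ι, ∏ i, N (g i) (g (finRotate m i)) := by
  obtain ⟨m, rfl⟩ := Nat.exists_eq_succ_of_ne_zero hm
  rw [← (Fin.consEquiv (fun _ => ι)).sum_comp, Fintype.sum_prod_type]
  simp only [Matrix.trace, Matrix.diag, Nat.succ_eq_add_one, pow_apply_eq_sum_walk]
  refine Finset.sum_congr rfl fun a _ => Finset.sum_congr rfl fun g _ => ?_
  refine Finset.prod_congr rfl fun i _ => ?_
  have := congrFun (Fin.snoc_eq_cons_rotate g a) i
  simp only [Fin.consEquiv, Equiv.coe_fn_mk]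
  rw [this]

/-- Only functions equal to `i₀` off the image of `e` contribute, and these are the extensions of
functions on `Fin m`. -/
theorem pinnedSum_of_rotate (N : Matrix ι ι ℂ) (i₀ : ι) {m : ℕ} (e : Fin m → α)
    (he : Function.Injective e) (σ : Equiv.Perm α) (hσ : ∀ i, σ (e i) = e (finRotate m i)) :
    pinnedSum N i₀ (Finset.univ.image e) σ = ∑ g : Fin m → ι, ∏ i, N (g i) (g (finRotate m i)) := by
  symm
  refine Fintype.sum_of_injective (fun g => Function.extend e g fun _ => i₀)
    (Function.extend_injective he _) _ _ ?_ ?_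
  · intro f hf
    by_contra h0
    apply hf
    refine ⟨f ∘ e, ?_⟩
    funext l
    by_cases hl : ∃ i, e i = l
    · obtain ⟨i, rfl⟩ := hl
      simp [he.extend_apply]
    · change Function.extend e (f ∘ e) (fun _ => i₀) l = f l
      rw [Function.extend_apply' _ _ _ hl]
      have := Finset.prod_ne_zero_iff.1 h0 l (Finset.mem_univ _)
      have hl' : l ∉ Finset.univ.image e := by simpa using hl
      rw [if_neg hl'] at this
      by_contra h
      exact this (if_neg (Ne.symm h))
  · intro g
    refine Fintype.prod_of_injective e he _ _ ?_ ?_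
    · intro l hl
      have hl' : l ∉ Finset.univ.image e := by simpa using hl
      simp [hl', Function.extend_apply' g _ l hl]
    · intro i
      simp [hσ, he.extend_apply]

theorem pinnedSum_support_of_isCycle (N : Matrix ι ι ℂ) (i₀ : ι) {σ : Equiv.Perm α}
    (hσ : σ.IsCycle) : pinnedSum N i₀ σ.support σ = (N ^ #σ.support).trace := by
  obtain ⟨x, hx, hx'⟩ := id hσ
  obtain ⟨m, hm⟩ : ∃ m, #σ.support = m + 1 :=
    Nat.exists_eq_succ_of_ne_zero (by have := hσ.two_le_card_support; omega)
  have hord : orderOf σ = m + 1 := hσ.orderOf.trans hm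
  have hpow : ∀ i, (σ ^ i) x = x → m + 1 ∣ i := fun i hi => by
    rw [← hord]
    exact orderOf_dvd_of_pow_eq_one (hσ.pow_eq_one_iff.2 ⟨x, hx, hi⟩)
  let e : Fin (m + 1) → α := fun i => (σ ^ (i : ℕ)) x
  have he : Function.Injective e := by
    have key : ∀ i j : Fin (m + 1), i ≤ j → e i = e j → i = j := fun i j hij h => by
      have h1 : (σ ^ ((j : ℕ) - i)) x = x := by
        apply (σ ^ (i : ℕ)).injective
        rw [← Equiv.Perm.mul_apply, ← pow_add, Nat.add_sub_cancel' hij]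
        exact h.symm
      have := Nat.eq_zero_of_dvd_of_lt (hpow _ h1) (by omega)
      ext
      have hij' : (i : ℕ) ≤ j := hij
      omega
    intro i j h
    rcases le_total i j with hij | hij
    · exact key i j hij h
    · exact (key j i hij h.symm).symm
  have hrot : ∀ i, σ (e i) = e (finRotate (m + 1) i) := fun i => by
    change σ ((σ ^ (i : ℕ)) x) = (σ ^ (finRotate (m + 1) i : ℕ)) x
    rw [← Equiv.Perm.mul_apply, ← pow_succ']
    by_cases hi : i = Fin.last m
    · subst hi
      simp [← hord, pow_orderOf_eq_one]
    · rw [coe_finRotate_of_ne_last hi]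
  have himg : Finset.univ.image e = σ.support := by
    apply Finset.eq_of_subset_of_card_le
    · intro y hy
      obtain ⟨i, -, rfl⟩ := Finset.mem_image.1 hy
      exact Equiv.Perm.pow_apply_mem_support.2 (Equiv.Perm.mem_support.2 hx)
    · rw [Finset.card_image_of_injective _ he, hm]
      simp
  rw [← himg, pinnedSum_of_rotate N i₀ e he σ hrot, himg, hm, trace_pow_eq_sum_rotate N (by simp)]

theorem pinnedSum_support (N : Matrix ι ι ℂ) (i₀ : ι) (σ : Equiv.Perm α) :
    pinnedSum N i₀ σ.support σ = (σ.cycleType.map fun m => (N ^ m).trace).prod := by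
  induction σ using Equiv.Perm.cycle_induction_on with
  | base_one => simp [pinnedSum_one]
  | base_cycles σ hσ => simp [pinnedSum_support_of_isCycle N i₀ hσ, hσ.cycleType]
  | induction_disjoint σ τ hd _ hσ hτ =>
    rw [hd.cycleType_mul, Multiset.map_add, Multiset.prod_add, ← hσ, ← hτ,
      pinnedSum_mul N i₀ hd.disjoint_support (fun l hl => Equiv.Perm.notMem_support.1 hl)
        (fun l hl => Equiv.Perm.notMem_support.1 hl), hd.support_mul]

theorem sum_prod_perm_eq_prod_trace (N : Matrix ι ι ℂ) [Nonempty ι] (σ : Equiv.Perm α) :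
    ∑ f : α → ι, ∏ l, N (f l) (f (σ l)) =
      (σ.partition.parts.map fun m => (N ^ m).trace).prod := by
  obtain ⟨i₀⟩ := ‹Nonempty ι›
  have h := pinnedSum_mul N i₀ (S := σ.support) (T := σ.supportᶜ) (σ := σ) (τ := 1)
    disjoint_compl_right (fun l hl => Equiv.Perm.notMem_support.1 hl) (fun _ _ => rfl)
  -- The complement of the support, carrying the identity, supplies one factor tr N for each fixed
  -- point.
  rw [mul_one, Finset.union_compl, pinnedSum_support, pinnedSum_one] at h
  rw [Equiv.Perm.parts_partition, Multiset.map_add, Multiset.prod_add]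
  simp only [Multiset.map_replicate, Multiset.prod_replicate, pow_one]
  rw [← Finset.card_compl, h]
  simp [pinnedSum]

end CycleTraces

/-! ### Properties of tr_σ. -/

section Fin

variable {ι : Type*} [Fintype ι] [DecidableEq ι] {p : ℕ}

theorem sum_prod_perm_eq_tracePerm [Nonempty ι] (N : Matrix ι ι ℂ) (σ : Equiv.Perm (Fin p)) :
    ∑ f : Fin p → ι, ∏ l, N (f l) (f (σ l)) = tracePerm σ N :=
  sum_prod_perm_eq_prod_trace N σ

theorem tracePerm_inv (σ : Equiv.Perm (Fin p)) (N : Matrix ι ι ℂ) :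
    tracePerm σ⁻¹ N = tracePerm σ N := by
  simp [tracePerm, Equiv.Perm.parts_partition]

theorem tracePerm_mul_comm (σ τ : Equiv.Perm (Fin p)) (N : Matrix ι ι ℂ) :
    tracePerm (σ * τ) N = tracePerm (τ * σ) N := by
  have h : IsConj (σ * τ) (τ * σ) := isConj_iff.2 ⟨τ, by group⟩
  simp only [tracePerm, Equiv.Perm.partition_eq_of_isConj.1 h]

theorem tracePerm_conj (V V' : Matrix ι ι ℂ) (h : V' * V = 1) (X : Matrix ι ι ℂ)
    (σ : Equiv.Perm (Fin p)) : tracePerm σ (V * X * V') = tracePerm σ X := by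
  have hp : ∀ m : ℕ, (V * X * V') ^ m * V = V * X ^ m := fun m => by
    induction m with
    | zero => simp
    | succ m ih =>
      rw [pow_succ', mul_assoc, ih, pow_succ']
      simp only [mul_assoc]
      rw [← mul_assoc V' V, h, one_mul]
  have hV : V * V' = 1 := mul_eq_one_comm.1 h
  have ht : ∀ m : ℕ, ((V * X * V') ^ m).trace = (X ^ m).trace := fun m => by
    rw [← mul_one ((V * X * V') ^ m), ← hV, ← mul_assoc, hp, Matrix.trace_mul_comm, ← mul_assoc, h,
      one_mul]
  simp only [tracePerm, ht]

theorem tracePerm_one_eq_cyclePow (σ : Equiv.Perm (Fin p)) :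
    tracePerm σ (1 : Matrix ι ι ℂ) = (Fintype.card ι : ℂ) ^ numCycles σ := by
  simp [tracePerm, numCycles]

theorem sum_ite_comp_eq [Nonempty ι] (σ : Equiv.Perm (Fin p)) :
    (∑ f : Fin p → ι, if f ∘ σ = f then (1 : ℂ) else 0) =
      (Fintype.card ι : ℂ) ^ numCycles σ := by
  rw [← tracePerm_one_eq_cyclePow, ← sum_prod_perm_eq_tracePerm]
  refine Finset.sum_congr rfl fun f _ => ?_
  simp only [Matrix.one_apply, Finset.prod_boole, Finset.mem_univ, true_implies]
  congr 1
  simp only [funext_iff, Function.comp_apply, eq_comm]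

theorem tracePerm_finRotate (hp : 1 ≤ p) (N : Matrix ι ι ℂ) :
    tracePerm (finRotate p) N = (N ^ p).trace := by
  match p, hp with
  -- `finRotate 1` is the identity, with empty cycle type, so its single cycle is a fixed point.
  | 1, _ =>
    simp [tracePerm, Equiv.Perm.parts_partition, Subsingleton.elim (finRotate 1) 1]
  | p + 2, _ =>
    simp [tracePerm, Equiv.Perm.parts_partition, cycleType_finRotate, support_finRotate]

end Fin

/-! ### Zariski density of the unitary group. -/

section ZariskiDensity

variable {ι : Type*} [Fintype ι] [DecidableEq ι]

theorem infinite_setOf_star_mul_self_eq_one : {z : ℂ | star z * z = 1}.Infinite := by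
  refine Set.Infinite.mono ?_ ((Set.Ioc_infinite (show (0 : ℝ) < 1 by norm_num)).image
    (f := fun t : ℝ => Complex.exp (t * Complex.I)) ?_)
  · rintro _ ⟨t, -, rfl⟩
    simp [← Complex.exp_conj, ← Complex.exp_add]
  · intro s hs t ht h
    have hpi := Real.pi_gt_three
    have h2 := congrArg (fun z => (Complex.log z).im) h
    simp only at h2
    rw [Complex.log_exp, Complex.log_exp] at h2
    · simpa using h2
    all_goals
      simp only [Complex.mul_im, Complex.ofReal_re, Complex.I_im, Complex.ofReal_im,
        Complex.I_re, mul_one, mul_zero, add_zero]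
      simp only [Set.mem_Ioc] at hs ht
      linarith

-- Diagonalise H = W D W*. As a polynomial in the entries of D, P(W D W*) vanishes when all entries
-- lie on the unit circle, an infinite set; hence it vanishes identically, in particular at the real
-- eigenvalues.
open MvPolynomial in
theorem eval_hermitian_eq_zero_of_eval_unitary (P : MvPolynomial (ι × ι) ℂ)
    (hP : ∀ V ∈ Matrix.unitaryGroup ι ℂ, eval (fun x => V x.1 x.2) P = 0)
    {H : Matrix ι ι ℂ} (hH : H.IsHermitian) : eval (fun x => H x.1 x.2) P = 0 := by
  let W : Matrix ι ι ℂ := hH.eigenvectorUnitary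
  have hW : W ∈ Matrix.unitaryGroup ι ℂ := hH.eigenvectorUnitary.2
  let Q : MvPolynomial ι ℂ :=
    aeval (fun x : ι × ι => ∑ c, C (W x.1 c) * X c * C (star (W x.2 c))) P
  have hQ : ∀ D : ι → ℂ, eval D Q
      = eval (fun x => (W * Matrix.diagonal D * star W) x.1 x.2) P := fun D => by
    simp only [Q, aeval_def, ← coe_eval₂Hom]
    rw [← RingHom.comp_apply, comp_eval₂Hom]
    have : ((eval D).comp (algebraMap ℂ (MvPolynomial ι ℂ))) = RingHom.id ℂ := by
      ext; simp
    rw [this]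
    change eval₂Hom _ _ P = eval₂Hom _ _ P
    congr 2
    funext x
    simp [Matrix.mul_apply, Matrix.star_apply, mul_assoc,
      Matrix.diagonal_apply]
  have hQ0 : Q = 0 := by
    refine funext_set (fun _ => {z : ℂ | star z * z = 1})
      (fun _ => infinite_setOf_star_mul_self_eq_one) fun D hD => ?_
    rw [hQ, map_zero]
    apply hP
    have hD' : Matrix.diagonal D ∈ Matrix.unitaryGroup ι ℂ := by
      rw [Matrix.mem_unitaryGroup_iff']
      rw [Matrix.star_eq_conjTranspose, Matrix.diagonal_conjTranspose, Matrix.diagonal_mul_diagonal,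
        ← Matrix.diagonal_one]
      congr 1
      funext c
      exact hD c (Set.mem_univ c)
    exact mul_mem (mul_mem hW hD') (Unitary.star_mem hW)
  have hs := hH.spectral_theorem
  rw [Unitary.conjStarAlgAut_apply] at hs
  rw [hs]
  have := hQ (RCLike.ofReal ∘ hH.eigenvalues)
  rw [hQ0, map_zero] at this
  exact this.symm

open MvPolynomial in
/-- The unitary group is Zariski dense in the space of all matrices. -/
theorem eq_zero_of_eval_unitary (P : MvPolynomial (ι × ι) ℂ)
    (hP : ∀ V ∈ Matrix.unitaryGroup ι ℂ, eval (fun x => V x.1 x.2) P = 0) : P = 0 := by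
  apply MvPolynomial.funext
  intro y
  rw [map_zero]
  let M : Matrix ι ι ℂ := Matrix.of fun a b => y (a, b)
  let B : Matrix ι ι ℂ := realPart M
  let K : Matrix ι ι ℂ := imaginaryPart M
  have hB : B.IsHermitian := (realPart M).2
  have hK : K.IsHermitian := (imaginaryPart M).2
  have hM : B + Complex.I • K = M := realPart_add_I_smul_imaginaryPart M
  -- z ↦ P(B + zK) vanishes for real z, where B + zK is Hermitian; hence also at z = i, where it
  -- gives P(M).
  let Q : Polynomial ℂ := aeval (fun x : ι × ι =>
    Polynomial.C (B x.1 x.2) + Polynomial.X * Polynomial.C (K x.1 x.2)) P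
  have hQ : ∀ z : ℂ, Q.eval z = eval (fun x => (B + z • K) x.1 x.2) P := fun z => by
    simp only [Q, aeval_def, ← coe_eval₂Hom]
    rw [← Polynomial.coe_evalRingHom, ← RingHom.comp_apply, comp_eval₂Hom]
    have : ((Polynomial.evalRingHom z).comp (algebraMap ℂ (Polynomial ℂ))) = RingHom.id ℂ := by
      ext; simp
    rw [this]
    change eval₂Hom _ _ P = eval₂Hom _ _ P
    congr 2
    funext x
    simp only [Polynomial.coe_evalRingHom, Polynomial.eval_add, Polynomial.eval_C,
      Polynomial.eval_mul, Polynomial.eval_X, Matrix.add_apply, Matrix.smul_apply, smul_eq_mul]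
  have hQ0 : Q = 0 := by
    apply Polynomial.eq_zero_of_infinite_isRoot
    refine Set.Infinite.mono ?_ (Set.infinite_range_of_injective Complex.ofReal_injective)
    rintro _ ⟨t, rfl⟩
    rw [Set.mem_ofPred_eq, Polynomial.IsRoot.def, hQ]
    apply eval_hermitian_eq_zero_of_eval_unitary P hP
    apply hB.add
    rw [Matrix.IsHermitian, Matrix.conjTranspose_smul, hK.eq]
    simp
  have := hQ Complex.I
  rw [hQ0, hM] at this
  simpa [M] using this.symm

end ZariskiDensity

/-! ### Tensor powers and permutation operators. -/

section TensorPower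

set_option linter.unusedSectionVars false

variable {ι : Type*} [Fintype ι] [DecidableEq ι] {p : ℕ}

/-- The `p`-th tensor power of a matrix. -/
def tensorPow (p : ℕ) (M : Matrix ι ι ℂ) : Matrix (Fin p → ι) (Fin p → ι) ℂ :=
  Matrix.of fun i j => ∏ l, M (i l) (j l)

theorem tensorPow_mul (M N : Matrix ι ι ℂ) :
    tensorPow p (M * N) = tensorPow p M * tensorPow p N := by
  ext i j
  simp only [tensorPow, Matrix.mul_apply, Matrix.of_apply, ← Finset.prod_mul_distrib]
  rw [Finset.prod_univ_sum, Fintype.piFinset_univ]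

theorem tensorPow_one : tensorPow p (1 : Matrix ι ι ℂ) = 1 := by
  ext i j
  simp [tensorPow, Matrix.one_apply, Finset.prod_ite_zero, funext_iff]

/-- The operator permuting the tensor factors. -/
def permOp (ι : Type*) [Fintype ι] [DecidableEq ι] (σ : Equiv.Perm (Fin p)) :
    Matrix (Fin p → ι) (Fin p → ι) ℂ :=
  Matrix.of fun i j => if i ∘ σ = j then 1 else 0

theorem permOp_one : permOp ι (1 : Equiv.Perm (Fin p)) = 1 := by
  ext i j
  simp [permOp, Matrix.one_apply]

theorem permOp_mul (σ τ : Equiv.Perm (Fin p)) :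
    permOp ι (σ * τ) = permOp ι σ * permOp ι τ := by
  ext i j
  simp only [permOp, Matrix.mul_apply, Matrix.of_apply, ite_mul, one_mul, zero_mul,
    Finset.sum_ite_eq, Finset.mem_univ, if_true]
  rfl

theorem comp_perm_eq_iff (σ : Equiv.Perm (Fin p)) (i j : Fin p → ι) :
    i ∘ σ = j ↔ i = j ∘ ⇑σ⁻¹ := by
  constructor
  · rintro rfl
    funext l
    simp
  · rintro rfl
    funext l
    simp

theorem permOp_conjTranspose (σ : Equiv.Perm (Fin p)) :
    (permOp ι σ).conjTranspose = permOp ι σ⁻¹ := by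
  ext i j
  simp only [permOp, Matrix.conjTranspose_apply, Matrix.of_apply, comp_perm_eq_iff σ, apply_ite star,
    star_one, star_zero]
  simp only [eq_comm]

theorem permOp_mul_apply (σ : Equiv.Perm (Fin p)) (B : Matrix (Fin p → ι) (Fin p → ι) ℂ)
    (i j : Fin p → ι) : (permOp ι σ * B) i j = B (i ∘ σ) j := by
  simp [permOp, Matrix.mul_apply]

theorem mul_permOp_apply (σ : Equiv.Perm (Fin p)) (B : Matrix (Fin p → ι) (Fin p → ι) ℂ)
    (i j : Fin p → ι) : (B * permOp ι σ) i (j ∘ σ) = B i j := by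
  have : ∀ k : Fin p → ι, k ∘ σ = j ∘ σ ↔ k = j := fun k =>
    σ.surjective.injective_comp_right.eq_iff
  simp [permOp, Matrix.mul_apply, this]

theorem trace_mul_permOp (B : Matrix (Fin p → ι) (Fin p → ι) ℂ) (σ : Equiv.Perm (Fin p)) :
    (B * permOp ι σ).trace = ∑ i, B (i ∘ σ) i := by
  rw [Matrix.trace_mul_comm]
  simp only [Matrix.trace, Matrix.diag, permOp_mul_apply]

theorem trace_tensorPow_mul_permOp [Nonempty ι] (M : Matrix ι ι ℂ) (σ : Equiv.Perm (Fin p)) :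
    (tensorPow p M * permOp ι σ).trace = tracePerm σ M := by
  rw [← tracePerm_inv, ← sum_prod_perm_eq_tracePerm, trace_mul_permOp]
  refine Finset.sum_congr rfl fun i _ => ?_
  rw [← Equiv.prod_comp σ]
  simp [tensorPow]

theorem trace_permOp [Nonempty ι] (σ : Equiv.Perm (Fin p)) :
    (permOp ι σ).trace = (Fintype.card ι : ℂ) ^ numCycles σ := by
  rw [← tracePerm_one_eq_cyclePow, ← trace_tensorPow_mul_permOp, tensorPow_one, one_mul]

/-- Corresponding fibres have equal cardinality; glue bijections between them. -/
theorem exists_perm_comp_eq_of_map_eq {β κ : Type*} [Fintype β] {f g : β → κ}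
    (h : (Finset.univ.val.map f) = Finset.univ.val.map g) : ∃ σ : Equiv.Perm β, f ∘ σ = g := by
  classical
  have hc : ∀ c, Nonempty ({a // g a = c} ≃ {a // f a = c}) := fun c => by
    rw [← Fintype.card_eq, Fintype.card_subtype, Fintype.card_subtype]
    have := congrArg (Multiset.count c) h
    rw [Multiset.count_map, Multiset.count_map] at this
    simpa [Finset.card, Finset.filter_val, eq_comm] using this.symm
  refine ⟨Equiv.ofFiberEquiv fun c => (hc c).some, ?_⟩
  funext a
  exact Equiv.ofFiberEquiv_map _ a

open MvPolynomial in
/-- A linear form vanishing on the tensor powers of unitary matrices vanishes on all operators that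
commute with the permutations of the tensor factors. -/
theorem sum_mul_eq_zero_of_tensorPow_unitary (L : (Fin p → ι) → (Fin p → ι) → ℂ)
    (hL : ∀ V ∈ Matrix.unitaryGroup ι ℂ, ∑ i, ∑ j, L i j * tensorPow p V i j = 0)
    (B : Matrix (Fin p → ι) (Fin p → ι) ℂ)
    (hB : ∀ (σ : Equiv.Perm (Fin p)) i j, B (i ∘ σ) (j ∘ σ) = B i j) :
    ∑ i, ∑ j, L i j * B i j = 0 := by
  let mon : (Fin p → ι) → (Fin p → ι) → (ι × ι →₀ ℕ) := fun i j =>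
    ∑ l, Finsupp.single (i l, j l) 1
  let P : MvPolynomial (ι × ι) ℂ := ∑ i, ∑ j, monomial (mon i j) (L i j)
  have hP : P = 0 := by
    apply eq_zero_of_eval_unitary
    intro V hV
    rw [← hL V hV]
    simp only [P, map_sum, eval_monomial, tensorPow, Matrix.of_apply, mon]
    refine Finset.sum_congr rfl fun i _ => Finset.sum_congr rfl fun j _ => ?_
    congr 1
    rw [← Finsupp.prod_finsetSum_index (by simp) (by simp [pow_add])]
    simp
  -- The monomial of (i, j) determines the pair up to a simultaneous permutation, under which B is
  -- invariant. So M_{ij} ↦ B_{ij} induces a linear form on polynomials, which kills P = 0.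
  have hfac : Function.FactorsThrough (fun x : (Fin p → ι) × (Fin p → ι) => B x.1 x.2)
      (fun x => mon x.1 x.2) := by
    rintro ⟨i, j⟩ ⟨i', j'⟩ h
    have h2 := congrArg Finsupp.toMultiset h
    simp only [mon, map_sum, Finsupp.toMultiset_single, one_smul] at h2
    have h3 : ∀ i j : Fin p → ι, ∑ l, ({(i l, j l)} : Multiset (ι × ι))
        = Finset.univ.val.map fun l => (i l, j l) := fun i j => by
      rw [← Multiset.sum_map_singleton (Finset.univ.val.map _), Multiset.map_map]
      rfl
    rw [h3, h3] at h2
    obtain ⟨σ, hσ⟩ := exists_perm_comp_eq_of_map_eq h2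
    have e1 : i' = i ∘ σ := by funext l; exact (congrArg Prod.fst (congrFun hσ l)).symm
    have e2 : j' = j ∘ σ := by funext l; exact (congrArg Prod.snd (congrFun hσ l)).symm
    simp [e1, e2, hB]
  let b : (ι × ι →₀ ℕ) → ℂ := Function.extend (fun x : (Fin p → ι) × (Fin p → ι) => mon x.1 x.2)
    (fun x => B x.1 x.2) 0
  have hb : ∀ i j, b (mon i j) = B i j := fun i j => hfac.extend_apply 0 (i, j)
  have h0 : (basisMonomials (ι × ι) ℂ).constr ℂ b P = 0 := by rw [hP, map_zero]
  rw [← h0]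
  simp only [P, map_sum]
  refine Finset.sum_congr rfl fun i _ => Finset.sum_congr rfl fun j _ => ?_
  have h1 : monomial (mon i j) (L i j) = L i j • basisMonomials (ι × ι) ℂ (mon i j) := by
    simp [smul_monomial]
  rw [h1, map_smul, Module.Basis.constr_basis, hb, smul_eq_mul]

end TensorPower

/-! ### Double commutant and Schur–Weyl duality. -/

section DoubleCommutant

variable {ι : Type*} [Fintype ι] [DecidableEq ι] {p : ℕ}

/-- The representation of `S_p` on `(ℂ^ι)^{⊗p}` permuting the tensor factors. -/
noncomputable def permRep (ι : Type*) [Fintype ι] [DecidableEq ι] (p : ℕ) :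
    Representation ℂ (Equiv.Perm (Fin p)) ((Fin p → ι) → ℂ) where
  toFun σ := Matrix.toLin' (permOp ι σ)
  map_one' := by rw [permOp_one, Matrix.toLin'_one]; rfl
  map_mul' σ τ := by rw [permOp_mul, Matrix.toLin'_mul]; rfl

/-- An operator commuting with the commutant of the permutations of the tensor factors is a linear
combination of these permutations. -/
theorem exists_eq_sum_permOp_of_commute_commutant (A : Matrix (Fin p → ι) (Fin p → ι) ℂ)
    (hA : ∀ B : Matrix (Fin p → ι) (Fin p → ι) ℂ,
      (∀ σ : Equiv.Perm (Fin p), permOp ι σ * B = B * permOp ι σ) → A * B = B * A) :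
    ∃ c : Equiv.Perm (Fin p) → ℂ, A = ∑ σ, c σ • permOp ι σ := by
  classical
  let ρ := permRep ι p
  let e := ρ.asModuleEquiv
  have hcomm : ∀ (T : Module.End (MonoidAlgebra ℂ (Equiv.Perm (Fin p))) ρ.asModule)
      (x : ρ.asModule), A.mulVec (e (T x)) = e (T (e.symm (A.mulVec (e x)))) := fun T x => by
    let T' : ((Fin p → ι) → ℂ) →ₗ[ℂ] ((Fin p → ι) → ℂ) :=
      e.toLinearMap ∘ₗ (T.restrictScalars ℂ) ∘ₗ e.symm.toLinearMap
    have hT' : ∀ v, T' v = e (T (e.symm v)) := fun v => rfl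
    have hT : ∀ x, e (T x) = (LinearMap.toMatrix' T').mulVec (e x) := fun x => by
      rw [← Matrix.toLin'_apply, Matrix.toLin'_toMatrix', hT', e.symm_apply_apply]
    have hρ : ∀ σ v, T' (ρ σ v) = ρ σ (T' v) := fun σ v => by
      rw [hT', hT', ρ.asModuleEquiv_symm_map_rho σ v, map_smul, ρ.asModuleEquiv_map_smul,
        MonoidAlgebra.of_apply, Representation.asAlgebraHom_single_one]
    have := hA (LinearMap.toMatrix' T') fun σ => by
      apply Matrix.toLin'.injective
      rw [Matrix.toLin'_mul, Matrix.toLin'_mul, Matrix.toLin'_toMatrix']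
      exact LinearMap.ext fun v => (hρ σ v).symm
    rw [hT, hT, e.apply_symm_apply, Matrix.mulVec_mulVec, this, Matrix.mulVec_mulVec]
  -- Module endomorphisms are the commutant of S_p, so A is linear over them. Density on the
  -- standard basis then gives one group algebra element acting as A.
  let f : Module.End (Module.End (MonoidAlgebra ℂ (Equiv.Perm (Fin p))) ρ.asModule) ρ.asModule :=
    { toFun := fun x => e.symm (A.mulVec (e x))
      map_add' := fun x y => by rw [map_add, Matrix.mulVec_add, map_add]
      map_smul' := fun T x => by
        rw [Module.End.smul_def, hcomm, e.symm_apply_apply]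
        rfl }
  obtain ⟨r, hr⟩ := jacobson_density f
    (Finset.univ.image fun j : Fin p → ι => e.symm (Pi.single j 1))
  refine ⟨r.coeff, ?_⟩
  ext i j
  have h := congrArg e (hr _ (Finset.mem_image_of_mem _ (Finset.mem_univ j)))
  rw [ρ.asModuleEquiv_map_smul] at h
  have h2 := congrFun h i
  simp only [f, LinearMap.coe_mk, AddHom.coe_mk, LinearEquiv.apply_symm_apply] at h2
  have h3 : ρ.asAlgebraHom r = ∑ σ, r.coeff σ • ρ σ := by
    rw [Representation.asAlgebraHom_def, MonoidAlgebra.lift_apply,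
      Finsupp.sum_fintype _ _ (by simp)]
  change A.mulVec (Pi.single j 1) i = (ρ.asAlgebraHom r) (Pi.single j 1) i at h2
  rw [h3] at h2
  simpa [ρ, permRep, Matrix.sum_apply] using h2

/-- **Schur–Weyl duality** for the unitary group. -/
theorem exists_eq_sum_permOp_of_commute_tensorPow (A : Matrix (Fin p → ι) (Fin p → ι) ℂ)
    (hA : ∀ V ∈ Matrix.unitaryGroup ι ℂ, A * tensorPow p V = tensorPow p V * A) :
    ∃ c : Equiv.Perm (Fin p) → ℂ, A = ∑ σ, c σ • permOp ι σ := by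
  refine exists_eq_sum_permOp_of_commute_commutant A fun B hB => ?_
  ext i j
  -- An entry of AM - MA is a linear form in M; vanishing on all V^{⊗p}, it vanishes on the
  -- commutant.
  have key : ∀ M : Matrix (Fin p → ι) (Fin p → ι) ℂ,
      ∑ a, ∑ b, ((if b = j then A i a else 0) - (if i = a then A b j else 0)) * M a b
        = (A * M) i j - (M * A) i j := fun M => by
    simp only [sub_mul, Finset.sum_sub_distrib, ite_mul, zero_mul, Matrix.mul_apply]
    congr 1
    · simp
    · rw [Finset.sum_comm]
      simp [mul_comm]
  rw [← sub_eq_zero, ← key]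
  refine sum_mul_eq_zero_of_tensorPow_unitary _ (fun V hV => ?_) B fun σ i j => ?_
  · rw [key, hA V hV, sub_self]
  · rw [← permOp_mul_apply σ B, hB σ, mul_permOp_apply]

end DoubleCommutant
-- Recovering an operator from its traces.
section Weingarten

variable {ι : Type*} [Fintype ι] [DecidableEq ι] {p : ℕ}

theorem conv_assoc {G : Type*} [Group G] [Fintype G] (f g h : G → ℂ) :
    conv (conv f g) h = conv f (conv g h) := by
  apply convMatrix_injective
  simp only [convMatrix_conv, mul_assoc]

theorem trace_sum_permOp_mul_permOp [Nonempty ι] (c : Equiv.Perm (Fin p) → ℂ)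
    (σ : Equiv.Perm (Fin p)) :
    ((∑ α, c α • permOp ι α) * permOp ι σ).trace = conv c (cyclePow (Fintype.card ι) p) σ⁻¹ := by
  rw [Finset.sum_mul, Matrix.trace_sum]
  refine Finset.sum_congr rfl fun α _ => ?_
  rw [smul_mul_assoc, ← permOp_mul, Matrix.trace_smul, trace_permOp, smul_eq_mul]
  change c α * cyclePow (Fintype.card ι) p (α * σ) = _
  rw [← mul_inv_rev, cyclePow_inv, cyclePow_class]
  simp [cyclePow]

/-- The adjoint of a permutation operator is again one, so the hypothesis forces tr(EE*) = 0 for the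
combination E. -/
theorem eq_zero_of_trace_mul_permOp_eq_zero (e : Equiv.Perm (Fin p) → ℂ)
    (h : ∀ σ, ((∑ α, e α • permOp ι α) * permOp ι σ).trace = 0) :
    ∑ α, e α • permOp ι α = 0 := by
  open scoped ComplexOrder in
  rw [← Matrix.trace_mul_conjTranspose_self_eq_zero_iff, Matrix.conjTranspose_sum, Finset.mul_sum,
    Matrix.trace_sum]
  refine Finset.sum_eq_zero fun σ _ => ?_
  rw [Matrix.conjTranspose_smul, permOp_conjTranspose, mul_smul_comm, Matrix.trace_smul, h,
    smul_zero]

/-- A linear combination of the permutations of the tensor factors is determined by its traces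
against these permutations, through the Weingarten function. -/
theorem sum_permOp_eq_sum_weingarten [Nonempty ι] (c t : Equiv.Perm (Fin p) → ℂ)
    (ht : ∀ σ τ, t (σ * τ) = t (τ * σ)) (ht' : ∀ σ, t σ⁻¹ = t σ)
    (h : ∀ σ, ((∑ α, c α • permOp ι α) * permOp ι σ).trace = t σ) :
    ∑ α, c α • permOp ι α =
      ∑ α, (∑ β, t β * weingarten (Fintype.card ι) p (α * β⁻¹)) • permOp ι α := by
  have hc : conv c (cyclePow (Fintype.card ι) p) = t := by
    funext σ
    rw [← ht', ← h, trace_sum_permOp_mul_permOp, inv_inv]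
  have hw : ∀ α, ∑ β, t β * weingarten (Fintype.card ι) p (α * β⁻¹)
      = conv t (weingarten (Fintype.card ι) p) α := fun α => by
    rw [conv_comm_of_class ht]
    refine Fintype.sum_equiv ((Equiv.inv _).trans (Equiv.mulLeft α)) _ _ fun τ => ?_
    simp [mul_comm]
  -- As t = c ∗ d^{#}, the identity d^{#} ∗ Wg ∗ d^{#} = d^{#} suffices: t ∗ Wg has the same traces
  -- as c, though it may differ from c.
  have hc' : conv (conv t (weingarten (Fintype.card ι) p)) (cyclePow (Fintype.card ι) p) = t := by
    rw [← hc, conv_assoc, conv_assoc c, ← conv_assoc (cyclePow _ _), (weingarten_spec _ _).left]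
  simp only [hw]
  rw [← sub_eq_zero, ← Finset.sum_sub_distrib]
  simp only [← sub_smul]
  refine eq_zero_of_trace_mul_permOp_eq_zero _ fun σ => ?_
  simp only [sub_smul]
  rw [Finset.sum_sub_distrib, sub_mul, Matrix.trace_sub, trace_sum_permOp_mul_permOp,
    trace_sum_permOp_mul_permOp, hc, hc', sub_self]

end Weingarten

/-! ### The sum of d^{#σ} by Burnside's lemma. -/

section CycleCount

theorem card_orbits_domMulAct_perm (ι : Type*) [Fintype ι] [DecidableEq ι] (p : ℕ)
    [Fintype (MulAction.orbitRel.Quotient (Equiv.Perm (Fin p))ᵈᵐᵃ (Fin p → ι))] :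
    Fintype.card (MulAction.orbitRel.Quotient (Equiv.Perm (Fin p))ᵈᵐᵃ (Fin p → ι))
      = (Fintype.card ι).multichoose p := by
  rw [← Sym.card_sym_eq_multichoose ι p]
  have hrel : ∀ f g : Fin p → ι, MulAction.orbitRel (Equiv.Perm (Fin p))ᵈᵐᵃ (Fin p → ι) f g ↔
      Finset.univ.val.map f = Finset.univ.val.map g := fun f g => by
    rw [MulAction.orbitRel_apply]
    constructor
    · rintro ⟨σ, rfl⟩
      let τ : Equiv.Perm (Fin p) := DomMulAct.mk.symm σ
      change Multiset.map (g ∘ τ) Finset.univ.val = _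
      rw [← Multiset.map_map]
      congr 1
      exact congrArg Finset.val (Finset.map_univ_equiv τ)
    · intro h
      obtain ⟨σ, hσ⟩ := exists_perm_comp_eq_of_map_eq h.symm
      exact ⟨DomMulAct.mk σ, hσ⟩
  refine Fintype.card_of_bijective (f := Quotient.lift
    (fun f : Fin p → ι => (⟨Finset.univ.val.map f, by simp⟩ : Sym ι p))
    fun f g h => Subtype.ext ((hrel f g).1 h)) ⟨?_, ?_⟩
  · rintro ⟨f⟩ ⟨g⟩ h
    exact Quotient.sound ((hrel f g).2 (congrArg Subtype.val h))
  · rintro ⟨s, hs⟩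
    induction s using Quotient.inductionOn with
    | h l =>
      have hs' : l.length = p := hs
      subst hs'
      refine ⟨Quotient.mk _ l.get, Subtype.ext ?_⟩
      change Multiset.map l.get Finset.univ.val = (l : Multiset ι)
      simp

/-- d^{#σ} counts the functions `Fin p → Fin d` fixed by σ, and orbits of such functions are
multisets of size p, so the sum is p! · C(d+p-1, p). -/
theorem sum_cyclePow {d : ℕ} (hd : 1 ≤ d) (p : ℕ) :
    ∑ σ, cyclePow d p σ = ∏ j ∈ Finset.range p, ((d : ℂ) + (j : ℂ)) := by
  classical
  have : Nonempty (Fin d) := ⟨⟨0, hd⟩⟩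
  let _ : Fintype (Equiv.Perm (Fin p))ᵈᵐᵃ := Fintype.ofEquiv _ DomMulAct.mk
  have hfix : ∀ σ : Equiv.Perm (Fin p), cyclePow d p σ
      = (Fintype.card (MulAction.fixedBy (Fin p → Fin d) (DomMulAct.mk σ)) : ℂ) := fun σ => by
    have := sum_ite_comp_eq (ι := Fin d) σ
    rw [Fintype.card_fin] at this
    rw [cyclePow, ← this, Finset.sum_boole, Fintype.card_subtype]
    rfl
  have hb := MulAction.sum_card_fixedBy_eq_card_orbits_mul_card_group
    (Equiv.Perm (Fin p))ᵈᵐᵃ (Fin p → Fin d)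
  rw [card_orbits_domMulAct_perm, Fintype.card_fin, ← Fintype.card_congr DomMulAct.mk,
    Fintype.card_perm, Fintype.card_fin, ← DomMulAct.mk.sum_comp] at hb
  simp only [hfix]
  rw [← Nat.cast_sum, hb, Nat.multichoose_eq]
  have h2 : (d + p - 1).choose p * p.factorial = d.ascFactorial p := by
    obtain ⟨d, rfl⟩ := Nat.exists_eq_add_of_le' hd
    rw [Nat.ascFactorial_eq_factorial_mul_choose, mul_comm]
    congr 2
    omega
  rw [h2, Nat.ascFactorial_eq_prod_range]
  push_cast
  rfl

end CycleCount

/-! ### The Haar average of (VXV*)^{⊗p}. -/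

section HaarAverage

variable {ι : Type*} [Fintype ι] [DecidableEq ι] {p : ℕ}

theorem norm_conj_unitary_apply_le {V : Matrix ι ι ℂ} (hV : V ∈ Matrix.unitaryGroup ι ℂ)
    (X : Matrix ι ι ℂ) (i j : ι) : ‖(V * X * V.conjTranspose) i j‖ ≤ ∑ a, ∑ b, ‖X b a‖ := by
  simp only [Matrix.mul_apply, Finset.sum_mul]
  refine (norm_sum_le _ _).trans (Finset.sum_le_sum fun a _ => (norm_sum_le _ _).trans
    (Finset.sum_le_sum fun b _ => ?_))
  rw [norm_mul, norm_mul, Matrix.conjTranspose_apply, norm_star]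
  have h1 := entry_norm_bound_of_unitary hV i b
  have h2 := entry_norm_bound_of_unitary hV j a
  calc ‖V i b‖ * ‖X b a‖ * ‖V j a‖ ≤ 1 * ‖X b a‖ * 1 := by gcongr
    _ = ‖X b a‖ := by ring

variable [MeasurableSpace (Matrix.unitaryGroup ι ℂ)] [BorelSpace (Matrix.unitaryGroup ι ℂ)]

theorem integrable_tensorPow_conj (μ : Measure (Matrix.unitaryGroup ι ℂ)) [IsFiniteMeasure μ]
    (X : Matrix ι ι ℂ) (i j : Fin p → ι) :
    Integrable (fun V : Matrix.unitaryGroup ι ℂ =>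
      tensorPow p ((V : Matrix ι ι ℂ) * X * (V : Matrix ι ι ℂ).conjTranspose) i j) μ := by
  refine Integrable.of_bound (C := ∏ _l : Fin p, ∑ a, ∑ b, ‖X b a‖) ?_
    (Filter.Eventually.of_forall fun V => ?_)
  · apply Continuous.aestronglyMeasurable
    simp only [tensorPow, Matrix.of_apply]
    refine continuous_finsetProd _ fun l _ => ?_
    apply Continuous.matrix_elem
    have h : Continuous fun V : Matrix.unitaryGroup ι ℂ => (V : Matrix ι ι ℂ) :=
      continuous_subtype_val
    exact (h.matrix_mul continuous_const).matrix_mul h.matrix_conjTranspose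
  · simp only [tensorPow, Matrix.of_apply, norm_prod]
    exact Finset.prod_le_prod (fun _ _ => norm_nonneg _)
      fun l _ => norm_conj_unitary_apply_le V.2 X _ _

/-- The average of `(V X V^*)^{⊗p}` over the measure `μ`. -/
noncomputable def tensorAverage (p : ℕ) (μ : Measure (Matrix.unitaryGroup ι ℂ))
    (X : Matrix ι ι ℂ) : Matrix (Fin p → ι) (Fin p → ι) ℂ :=
  Matrix.of fun i j => ∫ V : Matrix.unitaryGroup ι ℂ,
    tensorPow p ((V : Matrix ι ι ℂ) * X * (V : Matrix ι ι ℂ).conjTranspose) i j ∂μ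

/-- The substitution V ↦ WV shows that conjugation by W^{⊗p} fixes the average. -/
theorem tensorPow_mul_tensorAverage (μ : Measure (Matrix.unitaryGroup ι ℂ)) [IsFiniteMeasure μ]
    [μ.IsMulLeftInvariant] (X : Matrix ι ι ℂ) {W : Matrix ι ι ℂ}
    (hW : W ∈ Matrix.unitaryGroup ι ℂ) :
    tensorAverage p μ X * tensorPow p W = tensorPow p W * tensorAverage p μ X := by
  have hWW : W.conjTranspose * W = 1 := Matrix.mem_unitaryGroup_iff'.1 hW
  have key : tensorPow p W * tensorAverage p μ X * tensorPow p W.conjTranspose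
      = tensorAverage p μ X := by
    ext i j
    simp only [Matrix.mul_apply (M := tensorPow p W * tensorAverage p μ X),
      Matrix.mul_apply (M := tensorPow p W)]
    have hint := fun a b => integrable_tensorPow_conj (p := p) μ X a b
    simp only [tensorAverage, Matrix.of_apply]
    rw [← integral_mul_left_eq_self _ (⟨W, hW⟩ : Matrix.unitaryGroup ι ℂ)]
    simp only [← integral_const_mul]
    simp only [← integral_finsetSum _ fun a _ => (hint a _).const_mul _]
    simp only [← integral_mul_const]
    rw [← integral_finsetSum _ fun b _ =>
      (integrable_finsetSum _ fun a _ => (hint a b).const_mul _).mul_const _]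
    congr 1
    funext V
    have : W * (V : Matrix ι ι ℂ) * X * (W * (V : Matrix ι ι ℂ)).conjTranspose
        = W * ((V : Matrix ι ι ℂ) * X * (V : Matrix ι ι ℂ).conjTranspose) * W.conjTranspose := by
      rw [Matrix.conjTranspose_mul]
      simp only [mul_assoc]
    change _ = tensorPow p (W * (V : Matrix ι ι ℂ) * X * (W * (V : Matrix ι ι ℂ)).conjTranspose) i j
    rw [this]
    generalize (V : Matrix ι ι ℂ) * X * (V : Matrix ι ι ℂ).conjTranspose = N
    rw [tensorPow_mul, tensorPow_mul]
    simp only [Matrix.mul_apply]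
  calc tensorAverage p μ X * tensorPow p W
      = tensorPow p W * tensorAverage p μ X * (tensorPow p W.conjTranspose * tensorPow p W) := by
        rw [← mul_assoc, key]
    _ = tensorPow p W * tensorAverage p μ X := by
        rw [← tensorPow_mul, hWW, tensorPow_one, mul_one]

theorem trace_tensorAverage_mul_permOp [Nonempty ι] (μ : Measure (Matrix.unitaryGroup ι ℂ))
    [IsProbabilityMeasure μ] (X : Matrix ι ι ℂ) (σ : Equiv.Perm (Fin p)) :
    (tensorAverage p μ X * permOp ι σ).trace = tracePerm σ X := by
  rw [trace_mul_permOp]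
  simp only [tensorAverage, Matrix.of_apply]
  rw [← integral_finsetSum _ fun i _ => integrable_tensorPow_conj μ X _ _]
  have : ∀ V : Matrix.unitaryGroup ι ℂ, ∑ i, tensorPow p
      ((V : Matrix ι ι ℂ) * X * (V : Matrix ι ι ℂ).conjTranspose) (i ∘ σ) i = tracePerm σ X :=
    fun V => by
      rw [← trace_mul_permOp, trace_tensorPow_mul_permOp, tracePerm_conj]
      exact Matrix.mem_unitaryGroup_iff'.1 V.2
  simp [this]

/-- The **Weingarten formula** for the average of `(V X V^*)^{⊗p}` over the unitary group. -/
theorem tensorAverage_eq_sum_weingarten [Nonempty ι] (μ : Measure (Matrix.unitaryGroup ι ℂ))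
    [IsProbabilityMeasure μ] [μ.IsMulLeftInvariant] (X : Matrix ι ι ℂ) :
    tensorAverage p μ X =
      ∑ α, (∑ β, tracePerm β X * weingarten (Fintype.card ι) p (α * β⁻¹)) • permOp ι α := by
  obtain ⟨c, hc⟩ := exists_eq_sum_permOp_of_commute_tensorPow (tensorAverage p μ X)
    fun W hW => tensorPow_mul_tensorAverage μ X hW
  rw [hc]
  refine sum_permOp_eq_sum_weingarten c (fun σ => tracePerm σ X)
    (fun σ τ => tracePerm_mul_comm σ τ X) (fun σ => tracePerm_inv σ X) fun σ => ?_
  rw [← hc, trace_tensorAverage_mul_permOp]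

end HaarAverage

/-! ### The trace of a power of the partial trace as a linear form. -/

section PartialTrace

variable {n k p : ℕ}

theorem trace_pow_partialTrace (hn : 1 ≤ n) (hp : 1 ≤ p)
    (M : Matrix (Fin n × Fin k) (Fin n × Fin k) ℂ) :
    ((partialTrace M) ^ p).trace = ∑ a : Fin p → Fin n, ∑ s : Fin p → Fin k,
      tensorPow p M (fun l => (a l, s l)) (fun l => (a (gammaCycle p l), s l)) := by
  have : Nonempty (Fin n) := ⟨⟨0, hn⟩⟩
  rw [← tracePerm_finRotate hp, ← tracePerm_inv, ← sum_prod_perm_eq_tracePerm]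
  refine Finset.sum_congr rfl fun a _ => ?_
  simp only [partialTrace, Matrix.of_apply, tensorPow]
  rw [Finset.prod_univ_sum, Fintype.piFinset_univ]
  rfl

theorem sum_permOp_partialTrace (hn : 1 ≤ n) (hk : 1 ≤ k) (α : Equiv.Perm (Fin p)) :
    ∑ a : Fin p → Fin n, ∑ s : Fin p → Fin k, permOp (Fin n × Fin k) α
      (fun l => (a l, s l)) (fun l => (a (gammaCycle p l), s l)) =
    (k : ℂ) ^ numCycles α * (n : ℂ) ^ numCycles ((gammaCycle p)⁻¹ * α) := by
  have : Nonempty (Fin n) := ⟨⟨0, hn⟩⟩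
  have : Nonempty (Fin k) := ⟨⟨0, hk⟩⟩
  have h1 : (n : ℂ) ^ numCycles ((gammaCycle p)⁻¹ * α)
      = (n : ℂ) ^ numCycles (α * (gammaCycle p)⁻¹) := cyclePow_class n p _ _
  have e1 := sum_ite_comp_eq (ι := Fin n) (α * (gammaCycle p)⁻¹)
  have e2 := sum_ite_comp_eq (ι := Fin k) α
  rw [Fintype.card_fin] at e1 e2
  rw [h1, ← e1, ← e2, mul_comm, Finset.sum_mul_sum]
  refine Finset.sum_congr rfl fun a _ => Finset.sum_congr rfl fun s _ => ?_
  -- The entry of P_α is 1 exactly when a∘α = a∘γ and s∘α = s, so the sums over a and s separate.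
  have h2 : a ∘ ⇑(α * (gammaCycle p)⁻¹) = a ↔ ∀ l, a (α l) = a (gammaCycle p l) := by
    rw [funext_iff, ← (gammaCycle p).forall_congr_right]
    simp
  rw [ite_zero_mul_ite_zero, mul_one]
  simp only [h2, permOp, Matrix.of_apply, funext_iff, Function.comp_apply, Prod.mk.injEq,
    forall_and]

end PartialTrace

/-! ### Rank-one idempotents. -/

section RankOne

theorem trace_eq_rank_of_isIdempotentElem {ι : Type*} [Fintype ι] [DecidableEq ι]
    {X : Matrix ι ι ℂ} (hX : IsIdempotentElem X) : X.trace = X.rank := by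
  have h : IsIdempotentElem (Matrix.toLin' X) := by
    rw [IsIdempotentElem, Module.End.mul_eq_comp, ← Matrix.toLin'_mul, hX.eq]
  have h2 := (LinearMap.isProj_range_iff_isIdempotentElem _).2 h
  rw [← Matrix.trace_toLin'_eq, h2.trace]
  rfl

theorem tracePerm_eq_one_of_rank_one {ι : Type*} [Fintype ι] [DecidableEq ι] {p : ℕ}
    {X : Matrix ι ι ℂ} (hX : IsIdempotentElem X) (h1 : X.rank = 1) (σ : Equiv.Perm (Fin p)) :
    tracePerm σ X = 1 := by
  refine Multiset.prod_eq_one fun x hx => ?_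
  obtain ⟨m, hm, rfl⟩ := Multiset.mem_map.1 hx
  have hm0 : m ≠ 0 := (σ.partition.parts_pos hm).ne'
  rw [hX.pow_eq hm0, trace_eq_rank_of_isIdempotentElem hX, h1, Nat.cast_one]

end RankOne

/-! ### Moments of the partial trace. -/

section Moments

variable {n k p : ℕ}

theorem integrable_trace_pow_partialTrace (hn : 1 ≤ n) (hp : 1 ≤ p)
    [MeasurableSpace (Matrix.unitaryGroup (Fin n × Fin k) ℂ)]
    [BorelSpace (Matrix.unitaryGroup (Fin n × Fin k) ℂ)]
    (μ : Measure (Matrix.unitaryGroup (Fin n × Fin k) ℂ)) [IsFiniteMeasure μ]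
    (X : Matrix (Fin n × Fin k) (Fin n × Fin k) ℂ) :
    Integrable (fun V : Matrix.unitaryGroup (Fin n × Fin k) ℂ =>
      ((partialTrace ((V : Matrix (Fin n × Fin k) (Fin n × Fin k) ℂ) * X *
        (V : Matrix (Fin n × Fin k) (Fin n × Fin k) ℂ).conjTranspose)) ^ p).trace) μ := by
  simp only [trace_pow_partialTrace hn hp]
  exact integrable_finsetSum _ fun a _ => integrable_finsetSum _ fun s _ =>
    integrable_tensorPow_conj μ X _ _

theorem integral_trace_pow_partialTrace (hn : 1 ≤ n) (hk : 1 ≤ k) (hp : 1 ≤ p)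
    [MeasurableSpace (Matrix.unitaryGroup (Fin n × Fin k) ℂ)]
    [BorelSpace (Matrix.unitaryGroup (Fin n × Fin k) ℂ)]
    (μ : Measure (Matrix.unitaryGroup (Fin n × Fin k) ℂ)) [IsFiniteMeasure μ]
    (X : Matrix (Fin n × Fin k) (Fin n × Fin k) ℂ) (c : Equiv.Perm (Fin p) → ℂ)
    (hc : tensorAverage p μ X = ∑ α, c α • permOp (Fin n × Fin k) α) :
    ∫ V : Matrix.unitaryGroup (Fin n × Fin k) ℂ,
      ((partialTrace ((V : Matrix (Fin n × Fin k) (Fin n × Fin k) ℂ) * X *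
        (V : Matrix (Fin n × Fin k) (Fin n × Fin k) ℂ).conjTranspose)) ^ p).trace ∂μ =
    ∑ α, c α * ((k : ℂ) ^ numCycles α * (n : ℂ) ^ numCycles ((gammaCycle p)⁻¹ * α)) := by
  simp only [trace_pow_partialTrace hn hp]
  rw [integral_finsetSum _ fun a _ => integrable_finsetSum _ fun s _ =>
    integrable_tensorPow_conj μ X _ _]
  simp only [integral_finsetSum _ fun s _ => integrable_tensorPow_conj μ X _ _]
  have h : ∀ i j, ∫ V : Matrix.unitaryGroup (Fin n × Fin k) ℂ,
      tensorPow p ((V : Matrix (Fin n × Fin k) (Fin n × Fin k) ℂ) * X *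
        (V : Matrix (Fin n × Fin k) (Fin n × Fin k) ℂ).conjTranspose) i j ∂μ
      = ∑ α, c α * permOp (Fin n × Fin k) α i j := fun i j => by
    have := congrFun (congrFun hc i) j
    simpa [tensorAverage, Matrix.sum_apply] using this
  simp only [h, ← sum_permOp_partialTrace hn hk, Finset.mul_sum]
  symm
  rw [Finset.sum_comm]
  exact Finset.sum_congr rfl fun a _ => Finset.sum_comm

end Moments

end RandomPartialTrace

theorem mainTheorem7 (n k p : ℕ) (hn : 1 ≤ n) (hk : 1 ≤ k) (hp : 1 ≤ p)
    (X : Matrix (Fin n × Fin k) (Fin n × Fin k) ℂ)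
    [MeasurableSpace (Matrix.unitaryGroup (Fin n × Fin k) ℂ)]
    [BorelSpace (Matrix.unitaryGroup (Fin n × Fin k) ℂ)]
    {Ω : Type*} [MeasurableSpace Ω] (P : Measure Ω) [IsProbabilityMeasure P]
    (U : Ω → Matrix.unitaryGroup (Fin n × Fin k) ℂ) (hU : AEMeasurable U P)
    (hHaar : (P.map U).IsHaarMeasure)
    (Y : Ω → Matrix (Fin n) (Fin n) ℂ)
    (hY : ∀ ω, Y ω = RandomPartialTrace.partialTrace
      ((U ω : Matrix (Fin n × Fin k) (Fin n × Fin k) ℂ) * X *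
        (U ω : Matrix (Fin n × Fin k) (Fin n × Fin k) ℂ).conjTranspose)) :
    Integrable (fun ω => ((Y ω) ^ p).trace) P ∧
    ∫ ω, ((Y ω) ^ p).trace ∂P =
      ∑ α : Equiv.Perm (Fin p), ∑ β : Equiv.Perm (Fin p),
        (k : ℂ) ^ RandomPartialTrace.numCycles α *
        (n : ℂ) ^ RandomPartialTrace.numCycles ((RandomPartialTrace.gammaCycle p)⁻¹ * α) *
        RandomPartialTrace.tracePerm β X *
        RandomPartialTrace.weingarten (n * k) p (α * β⁻¹) ∧
    (IsIdempotentElem X → X.rank = 1 →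
      ∫ ω, ((Y ω) ^ p).trace ∂P =
        (∏ j ∈ Finset.range p, ((n : ℂ) * (k : ℂ) + (j : ℂ)))⁻¹ *
        ∑ α : Equiv.Perm (Fin p),
          (k : ℂ) ^ RandomPartialTrace.numCycles α *
          (n : ℂ) ^ RandomPartialTrace.numCycles
            ((RandomPartialTrace.gammaCycle p)⁻¹ * α)) := by
  have : IsProbabilityMeasure (P.map U) := Measure.isProbabilityMeasure_map hU
  have : Nonempty (Fin n × Fin k) := ⟨(⟨0, hn⟩, ⟨0, hk⟩)⟩
  have hint := RandomPartialTrace.integrable_trace_pow_partialTrace hn hp (P.map U) X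
  have hmap := integral_map hU hint.aestronglyMeasurable
  have hW := RandomPartialTrace.tensorAverage_eq_sum_weingarten (p := p) (P.map U) X
  have hmom := RandomPartialTrace.integral_trace_pow_partialTrace hn hk hp (P.map U) X _ hW
  have hcard : Fintype.card (Fin n × Fin k) = n * k := by simp
  simp only [hY, ← hmap]
  refine ⟨hint.comp_aemeasurable hU, ?_, fun hX hr => ?_⟩
  · rw [hmom, hcard]
    refine Finset.sum_congr rfl fun α _ => ?_
    rw [Finset.sum_mul]
    refine Finset.sum_congr rfl fun β _ => ?_
    ring
  · simp only [RandomPartialTrace.tracePerm_eq_one_of_rank_one hX hr, one_mul] at hW hmom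
    set s : ℂ := ∑ β : Equiv.Perm (Fin p),
      RandomPartialTrace.weingarten (Fintype.card (Fin n × Fin k)) p β with hs
    have hconst : ∀ α : Equiv.Perm (Fin p), ∑ β : Equiv.Perm (Fin p),
        RandomPartialTrace.weingarten (Fintype.card (Fin n × Fin k)) p (α * β⁻¹) = s :=
      fun α => Fintype.sum_equiv ((Equiv.inv _).trans (Equiv.mulLeft α)) _ _ fun β => by simp
    simp only [hconst] at hW hmom
    -- The trace against the identity permutation determines s without evaluating Wg.
    have h1 := RandomPartialTrace.trace_tensorAverage_mul_permOp (p := p) (P.map U) X 1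
    rw [RandomPartialTrace.tracePerm_eq_one_of_rank_one hX hr, RandomPartialTrace.permOp_one,
      mul_one, hW, ← Finset.smul_sum, Matrix.trace_smul, Matrix.trace_sum] at h1
    simp only [RandomPartialTrace.trace_permOp] at h1
    have h2 := RandomPartialTrace.sum_cyclePow (d := n * k) (Nat.mul_pos hn hk) p
    simp only [RandomPartialTrace.cyclePow] at h2
    rw [hcard, h2, smul_eq_mul, Nat.cast_mul] at h1
    rw [hmom, ← Finset.mul_sum, eq_inv_of_mul_eq_one_left h1]
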